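/- There is a universal constant $C>0$ with the following property. Let $\Omega\subset\mathbb R^2$ be open and bounded, let $\mu,\nu$ be non-negative Radon measures on $\mathbb R^2$, let $\psi:\mathbb R^2\to\mathbb R$ be convex, and let $h_1,h_2,\lambda_1,\lambda_2,\delta>0$. Write $\partial\psi(x)=\{z\in\mathbb R^2:\psi(y)\ge\psi(x)+z\cdot(y-x)\ \forall y\in\mathbb R^2\}$ and $\partial\psi(A)=\bigcup_{x\in A}\partial\psi(x)$. Assume that $$\mu(A)\le\nu(\partial\psi(A))\quad\text{for all Borel sets }A\subset\Omega,$$ that $\mu(R)\ge |R|/\lambda_1$ for every closed rectangle $R\subset\Omega$ (of any orientation) with both side lengths at least $h_1$, and that $\nu(R'\cap\partial\psi(\Omega))\le\lambda_2|R'|$ for every closed rectangle $R'\subset\mathbb R^2$ (of any orientation) with both side lengths at least $h_2$. Let $x,y\in\Omega^\delta:=\{p\in\Omega:\operatorname{dist}(p,\partial\Omega)>\delta\}$ be such that $\Omega$ contains a rectangle with base $[x,y]$ and height $\delta$ (on one of the two sides of $[x,y]$); this is automatic if $\Omega$ is convex. Put $\ell:=|x-y|/2$ and let $K>0$ satisfy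 $K\ge\operatorname{diam}\partial\psi(U_\delta)$, where $U_\delta=\bigcup_{z\in[x,y]}B_\delta(z)$. Suppose that $\psi$ is affine on the segment $[x,y]$ and that $$h_1\le\frac\delta4,\qquad \sqrt{C\lambda_1\lambda_2}\,h_2<\delta,\qquad \frac{\ell h_2}{K}\le\frac{C\delta}{2}.$$ Then $$\ell\le\max\left\{2h_1,\ \sqrt{C\lambda_1\lambda_2Kh_2},\ \frac{K\sqrt{C\lambda_1\lambda_2}}{\left[\ln\left(\frac{\delta}{2h_1}\right)\right]^{1/8}},\ \frac{K\sqrt{C\lambda_1\lambda_2}}{\left[\ln\left(\frac{\delta}{\sqrt{C\lambda_1\lambda_2}\,h_2}\right)\right]^{1/8}}\right\}.$$ Moreover, for fixed $\lambda_1,\lambda_2,\delta,K>0$, the right-hand side tends to $0$ as $h_1,h_2\to0^+$. -/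

import Mathlib

open Set Filter Topology MeasureTheory

noncomputable section

/-- The Euclidean plane. -/
abbrev Plane : Type := EuclideanSpace ℝ (Fin 2)

/-- The (global) subdifferential of `ψ` at `x`. -/
def subdiff (ψ : Plane → ℝ) (x : Plane) : Set Plane :=
  {z | ∀ y, ψ x + inner ℝ z (y - x) ≤ ψ y}

/-- The image `∂ψ(A) = ⋃_{x ∈ A} ∂ψ(x)`. -/
def subdiffImage (ψ : Plane → ℝ) (A : Set Plane) : Set Plane :=
  ⋃ x ∈ A, subdiff ψ x

/-- `e, f` is an orthonormal frame of the plane. -/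
def IsFrame (e f : Plane) : Prop :=
  ‖e‖ = 1 ∧ ‖f‖ = 1 ∧ inner ℝ e f = 0

/-- The closed rectangle with corner `p`, side `a` in direction `e` and side `b` in direction `f`
(used with an orthonormal frame `e, f`, so rectangles of every orientation occur). -/
def rectangle (p e f : Plane) (a b : ℝ) : Set Plane :=
  {q | ∃ s ∈ Icc (0 : ℝ) a, ∃ t ∈ Icc (0 : ℝ) b, q = p + s • e + t • f}

/-- The inequality `μ(A) ≤ ν(∂ψ(A))` for all Borel sets `A ⊆ Ω`. -/
def TransportIneq (μ ν : Measure Plane) (ψ : Plane → ℝ) (Ω : Set Plane) : Prop :=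
  ∀ A : Set Plane, MeasurableSet A → A ⊆ Ω → μ A ≤ ν (subdiffImage ψ A)

/-- `μ(R) ≥ |R| / Λ₁` for all rectangles `R ⊆ Ω` with both sides at least `h₁`, and
`ν(R' ∩ ∂ψ(Ω)) ≤ Λ₂ |R'|` for all rectangles `R'` of the plane with both sides at least `h₂`. -/
structure MeasureBounds (μ ν : Measure Plane) (ψ : Plane → ℝ) (Ω : Set Plane)
    (h₁ h₂ Λ₁ Λ₂ : ℝ) : Prop where
  lower : ∀ (p e f : Plane) (a b : ℝ), IsFrame e f → h₁ ≤ a → h₁ ≤ b →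
    rectangle p e f a b ⊆ Ω →
    volume (rectangle p e f a b) / ENNReal.ofReal Λ₁ ≤ μ (rectangle p e f a b)
  upper : ∀ (p e f : Plane) (a b : ℝ), IsFrame e f → h₂ ≤ a → h₂ ≤ b →
    ν (rectangle p e f a b ∩ subdiffImage ψ Ω) ≤
      ENNReal.ofReal Λ₂ * volume (rectangle p e f a b)

/-- `Ω^δ`, the set of points of `Ω` at distance more than `δ` from the boundary (`Ω` is bounded
below, so that the boundary is nonempty as soon as `Ω` is). -/
def innerSet (Ω : Set Plane) (δ : ℝ) : Set Plane :=
  {x | x ∈ Ω ∧ δ < Metric.infDist x (frontier Ω)}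

/-- `U_δ`, the union of the open balls of radius `δ` centred on the segment `[x, y]`. -/
def segmentNhd (x y : Plane) (δ : ℝ) : Set Plane :=
  ⋃ z ∈ segment ℝ x y, Metric.ball z δ

/-- `Ω` contains a rectangle with base the segment `[x, y]` and height `δ`, on at least one of the
two sides of the segment. -/
def ContainsRectangleOn (Ω : Set Plane) (x y : Plane) (δ : ℝ) : Prop :=
  ∃ e f : Plane, IsFrame e f ∧ y = x + ‖y - x‖ • e ∧ rectangle x e f ‖y - x‖ δ ⊆ Ω

/-- `ψ` is affine on the segment `[x, y]`. -/
def AffineOnSegment (ψ : Plane → ℝ) (x y : Plane) : Prop :=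
  ∀ t ∈ Icc (0 : ℝ) 1, ψ ((1 - t) • x + t • y) = (1 - t) * ψ x + t * ψ y

/-- The upper bound on the half-length of a flat part. -/
def flatBound (C Λ₁ Λ₂ K δ h₁ h₂ : ℝ) : ℝ :=
  max (max (2 * h₁) (√(C * Λ₁ * Λ₂ * K * h₂)))
    (max (K * √(C * Λ₁ * Λ₂) / (Real.log (δ / (2 * h₁))) ^ (1 / 8 : ℝ))
      (K * √(C * Λ₁ * Λ₂) / (Real.log (δ / (√(C * Λ₁ * Λ₂) * h₂))) ^ (1 / 8 : ℝ)))

end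

theorem subdiff_nonempty {ψ : Plane → ℝ} (hψ : ConvexOn ℝ univ ψ) (x : Plane) :
    (subdiff ψ x).Nonempty := by
  have hcont : Continuous ψ := hψ.locallyLipschitz.continuous
  have hopen : IsOpen {p : Plane × ℝ | p.1 ∈ univ ∧ ψ p.1 < p.2} := by
    simpa using isOpen_lt (hcont.comp continuous_fst) continuous_snd
  obtain ⟨F, hF⟩ := geometric_hahn_banach_open_point (x := (x, ψ x))
    hψ.convex_strict_epigraph hopen (by simp)
  have hsplit : ∀ (y : Plane) (t : ℝ), F (y, t) = F (y, 0) + t * F (0, 1) := by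
    intro y t
    have : (y, t) = (y, (0 : ℝ)) + t • ((0 : Plane), (1 : ℝ)) := by simp
    rw [this, map_add, map_smul, smul_eq_mul]
  have hneg : F (0, 1) < 0 := by
    have := hF (x, ψ x + 1) ⟨mem_univ _, by simp⟩
    rw [hsplit, hsplit x (ψ x)] at this
    linarith
  set a := -F (0, 1) with ha
  have hapos : 0 < a := by linarith
  let G : Plane →L[ℝ] ℝ := F.comp (ContinuousLinearMap.inl ℝ Plane ℝ)
  refine ⟨(InnerProductSpace.toDual ℝ Plane).symm (a⁻¹ • G), fun y => ?_⟩
  have hle : F (y, 0) - F (x, 0) ≤ a * (ψ y - ψ x) := by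
    refine le_of_forall_pos_le_add fun ε hε => ?_
    have := hF (y, ψ y + ε / a) ⟨mem_univ _, by simpa using div_pos hε hapos⟩
    rw [hsplit, hsplit x (ψ x)] at this
    have h2 : ε / a * a = ε := div_mul_cancel₀ _ hapos.ne'
    have h3 : F (0, 1) = -a := by simp [ha]
    rw [h3] at this
    linarith
  rw [InnerProductSpace.toDual_symm_apply, map_sub]
  have hG : ∀ u, G u = F (u, 0) := fun u => by simp [G]
  simp only [smul_apply, hG, smul_eq_mul]
  rw [← mul_sub]
  have : a⁻¹ * (F (y, 0) - F (x, 0)) ≤ ψ y - ψ x := by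
    rw [inv_mul_le_iff₀ hapos]; exact hle
  linarith

theorem isBounded_subdiffImage {ψ : Plane → ℝ} (hψ : ConvexOn ℝ univ ψ) {A : Set Plane}
    (hA : Bornology.IsBounded A) : Bornology.IsBounded (subdiffImage ψ A) := by
  have hcont : Continuous ψ := hψ.locallyLipschitz.continuous
  have hcpt : IsCompact (closure (Metric.thickening 2 A)) := hA.thickening.isCompact_closure
  obtain ⟨M, hM⟩ := hcpt.exists_bound_of_continuousOn hcont.continuousOn
  rw [isBounded_iff_forall_norm_le]
  refine ⟨2 * M, fun p hp => ?_⟩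
  simp only [subdiffImage, mem_iUnion] at hp
  obtain ⟨q, hq, hp⟩ := hp
  have hq2 : q ∈ closure (Metric.thickening 2 A) :=
    subset_closure (Metric.self_subset_thickening two_pos A hq)
  have hunit : ‖‖p‖⁻¹ • p‖ ≤ 1 := by
    rw [norm_smul, norm_inv, norm_norm]
    exact inv_mul_le_one
  have hy : q + ‖p‖⁻¹ • p ∈ closure (Metric.thickening 2 A) := by
    refine subset_closure (Metric.mem_thickening_iff.2 ⟨q, hq, ?_⟩)
    rw [dist_eq_norm, add_sub_cancel_left]
    linarith
  have h := hp (q + ‖p‖⁻¹ • p)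
  rw [add_sub_cancel_left, inner_smul_right, real_inner_self_eq_norm_sq] at h
  have h1 := abs_le.1 (Real.norm_eq_abs _ ▸ hM _ hq2)
  have h2 := abs_le.1 (Real.norm_eq_abs _ ▸ hM _ hy)
  rcases eq_or_ne ‖p‖ 0 with h0 | h0
  · rw [h0]; linarith
  · have : ‖p‖⁻¹ * ‖p‖ ^ 2 = ‖p‖ := by field_simp
    linarith

theorem IsFrame.exists_orthonormalBasis {e f : Plane} (h : IsFrame e f) :
    ∃ b : OrthonormalBasis (Fin 2) ℝ Plane, b 0 = e ∧ b 1 = f := by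
  have hon : Orthonormal ℝ ![e, f] := by
    rw [orthonormal_iff_ite]
    intro i j
    fin_cases i <;> fin_cases j <;>
      simp [h.1, h.2.1, h.2.2, real_inner_comm e f]
  have hspan : ⊤ ≤ Submodule.span ℝ (Set.range ![e, f]) := by
    rw [hon.linearIndependent.span_eq_top_of_card_eq_finrank (by simp)]
  exact ⟨OrthonormalBasis.mk hon hspan, by simp, by simp⟩

theorem IsFrame.eq_add {e f : Plane} (h : IsFrame e f) (v : Plane) :
    v = inner ℝ v e • e + inner ℝ v f • f := by
  obtain ⟨b, rfl, rfl⟩ := h.exists_orthonormalBasis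
  have := b.sum_repr' v
  rw [Fin.sum_univ_two] at this
  rw [real_inner_comm, real_inner_comm (b 1)]
  exact this.symm

theorem rectangle_eq_preimage {b : OrthonormalBasis (Fin 2) ℝ Plane} (p : Plane) (u v : ℝ) :
    rectangle p (b 0) (b 1) u v = (fun q => WithLp.ofLp (b.repr q)) ⁻¹'
      Icc (WithLp.ofLp (b.repr p)) (WithLp.ofLp (b.repr p) + ![u, v]) := by
  ext q
  simp only [rectangle, mem_ofPred_eq, mem_preimage, mem_Icc, Pi.le_def, Fin.forall_fin_two,
    Pi.add_apply, Matrix.cons_val_zero, Matrix.cons_val_one]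
  constructor
  · rintro ⟨s, hs, t, ht, rfl⟩
    simp only [map_add, map_smul, OrthonormalBasis.repr_self, PiLp.add_apply, PiLp.smul_apply,
      PiLp.single_apply]
    simp [hs.1, hs.2, ht.1, ht.2]
  · rintro ⟨⟨h1, h2⟩, h3, h4⟩
    refine ⟨b.repr q 0 - b.repr p 0, ⟨by linarith, by linarith⟩,
      b.repr q 1 - b.repr p 1, ⟨by linarith, by linarith⟩, ?_⟩
    apply b.repr.injective
    ext i
    fin_cases i <;> simp [OrthonormalBasis.repr_self]

theorem measurePreserving_orthonormalBasis_coords (b : OrthonormalBasis (Fin 2) ℝ Plane) :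
    MeasurePreserving (fun q => WithLp.ofLp (b.repr q)) volume volume :=
  (PiLp.volume_preserving_ofLp (Fin 2)).comp b.measurePreserving_repr

theorem measurableSet_rectangle {e f : Plane} (h : IsFrame e f) (p : Plane) (u v : ℝ) :
    MeasurableSet (rectangle p e f u v) := by
  obtain ⟨b, rfl, rfl⟩ := h.exists_orthonormalBasis
  rw [rectangle_eq_preimage]
  exact (measurePreserving_orthonormalBasis_coords b).measurable measurableSet_Icc

theorem volume_rectangle {e f : Plane} (h : IsFrame e f) (p : Plane) {u v : ℝ} (hu : 0 ≤ u) :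
    volume (rectangle p e f u v) = ENNReal.ofReal (u * v) := by
  obtain ⟨b, rfl, rfl⟩ := h.exists_orthonormalBasis
  rw [rectangle_eq_preimage, (measurePreserving_orthonormalBasis_coords b).measure_preimage
    measurableSet_Icc.nullMeasurableSet, Real.volume_Icc_pi, Fin.prod_univ_two,
    ENNReal.ofReal_mul hu]
  simp

/-- If the subgradients over a rectangle in `Ω` have coordinates in a `W × H` box, the areas of
the two rectangles are comparable. -/
theorem area_le_of_subdiff_subset {μ ν : Measure Plane} {ψ : Plane → ℝ} {Ω : Set Plane}
    {h₁ h₂ Λ₁ Λ₂ : ℝ} (hΛ₁ : 0 < Λ₁) (hΛ₂ : 0 < Λ₂) (hh₁ : 0 < h₁) (hh₂ : 0 < h₂)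
    (hT : TransportIneq μ ν ψ Ω) (hB : MeasureBounds μ ν ψ Ω h₁ h₂ Λ₁ Λ₂)
    {p e f : Plane} {a b : ℝ} (hef : IsFrame e f) (ha : h₁ ≤ a) (hb : h₁ ≤ b)
    (hR : rectangle p e f a b ⊆ Ω) (p' : Plane) {W H : ℝ} (hW : h₂ ≤ W) (hH : h₂ ≤ H)
    (hsub : ∀ q ∈ rectangle p e f a b, ∀ z ∈ subdiff ψ q,
      inner ℝ (z - p') e ∈ Icc 0 W ∧ inner ℝ (z - p') f ∈ Icc 0 H) :
    a * b ≤ Λ₁ * Λ₂ * (W * H) := by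
  have hincl : subdiffImage ψ (rectangle p e f a b) ⊆
      rectangle p' e f W H ∩ subdiffImage ψ Ω := by
    intro z hz
    simp only [subdiffImage, mem_iUnion] at hz
    obtain ⟨q, hq, hz⟩ := hz
    refine ⟨⟨_, (hsub q hq z hz).1, _, (hsub q hq z hz).2, ?_⟩, ?_⟩
    · rw [add_assoc, ← hef.eq_add, add_sub_cancel]
    · simp only [subdiffImage, mem_iUnion]
      exact ⟨q, hR hq, hz⟩
  have key := calc volume (rectangle p e f a b) / ENNReal.ofReal Λ₁
      _ ≤ μ (rectangle p e f a b) := hB.lower p e f a b hef ha hb hR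
      _ ≤ ν (subdiffImage ψ (rectangle p e f a b)) := hT _ (measurableSet_rectangle hef _ _ _) hR
      _ ≤ ν (rectangle p' e f W H ∩ subdiffImage ψ Ω) := measure_mono hincl
      _ ≤ ENNReal.ofReal Λ₂ * volume (rectangle p' e f W H) := hB.upper p' e f W H hef hW hH
  have hW0 : 0 < W := hh₂.trans_le hW
  have hH0 : 0 < H := hh₂.trans_le hH
  rw [volume_rectangle hef _ (hh₁.le.trans ha), volume_rectangle hef _ hW0.le,
    ← ENNReal.ofReal_div_of_pos hΛ₁, ← ENNReal.ofReal_mul hΛ₂.le,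
    ENNReal.ofReal_le_ofReal_iff (by positivity), div_le_iff₀ hΛ₁] at key
  linarith

/-- A nonnegative convex function of two variables vanishing on the segment `[-ℓ, ℓ] × {0}`. -/
structure FlatProfile (φ : ℝ → ℝ → ℝ) (ℓ : ℝ) : Prop where
  convex : ConvexOn ℝ univ fun v : ℝ × ℝ => φ v.1 v.2
  nonneg : ∀ s t, 0 ≤ φ s t
  flat : ∀ s, |s| ≤ ℓ → φ s 0 = 0

namespace FlatProfile

variable {φ : ℝ → ℝ → ℝ} {ℓ : ℝ}

theorem le_mul (h : FlatProfile φ ℓ) {θ u : ℝ} (h0 : 0 ≤ θ) (h1 : θ ≤ 1) (hu : |u| ≤ ℓ) (s t : ℝ) :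
    φ ((1 - θ) * u + θ * s) (θ * t) ≤ θ * φ s t := by
  have := h.convex.2 (mem_univ (u, (0 : ℝ))) (mem_univ (s, t)) (sub_nonneg.2 h1) h0 (by ring)
  simpa [h.flat u hu] using this

theorem slope_mono (h : FlatProfile φ ℓ) (hℓ : 0 < ℓ) {t t' : ℝ} (ht : 0 < t) (htt : t ≤ t') :
    φ 0 t / t ≤ φ 0 t' / t' := by
  have ht' : 0 < t' := ht.trans_le htt
  have := h.le_mul (θ := t / t') (u := 0) (by positivity) ((div_le_one ht').2 htt)
    (by simpa using hℓ.le) 0 t'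
  rw [mul_zero, mul_zero, add_zero, div_mul_cancel₀ _ ht'.ne'] at this
  rw [div_le_iff₀ ht]
  calc φ 0 t ≤ t / t' * φ 0 t' := this
    _ = φ 0 t' / t' * t := by ring

theorem two_mul_center_le (h : FlatProfile φ ℓ) {s : ℝ} (hs : |s| ≤ ℓ) (t : ℝ) :
    2 * φ 0 (t / 2) ≤ φ s t := by
  have := h.le_mul (θ := 1 / 2) (u := -s) (by norm_num) (by norm_num) (by simpa using hs) s t
  rw [show (1 - 1 / 2) * -s + 1 / 2 * s = 0 by ring, show 1 / 2 * t = t / 2 by ring] at this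
  linarith

theorem two_mul_le_center (h : FlatProfile φ ℓ) {s : ℝ} (hs : |s| ≤ ℓ / 2) (t : ℝ) :
    2 * φ s t ≤ φ 0 (2 * t) := by
  have := h.le_mul (θ := 1 / 2) (u := 2 * s) (by norm_num) (by norm_num)
    (by rw [abs_mul, abs_two]; linarith) 0 (2 * t)
  rw [show (1 - 1 / 2) * (2 * s) + 1 / 2 * 0 = s by ring,
    show 1 / 2 * (2 * t) = t by ring] at this
  linarith

variable {s t p₁ p₂ : ℝ}

theorem le_of_subgradient (h : FlatProfile φ ℓ) (hs : |s| ≤ ℓ)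
    (hp : ∀ s' t', φ s t + p₁ * (s' - s) + p₂ * (t' - t) ≤ φ s' t') : φ s t ≤ p₂ * t := by
  have := hp s 0
  rw [h.flat s hs] at this
  linarith

theorem abs_mul_le_of_subgradient (h : FlatProfile φ ℓ) (hℓ : 0 < ℓ) (hs : |s| ≤ ℓ / 2)
    (hp : ∀ s' t', φ s t + p₁ * (s' - s) + p₂ * (t' - t) ≤ φ s' t') :
    |p₁| * ℓ ≤ 2 * (p₂ * t) := by
  have h0 := h.nonneg s t
  have h1 := hp ℓ 0
  have h2 := hp (-ℓ) 0
  rw [h.flat _ (abs_of_pos hℓ).le] at h1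
  rw [h.flat _ (by rw [abs_neg, abs_of_pos hℓ])] at h2
  obtain ⟨hs1, hs2⟩ := abs_le.1 hs
  rcases le_total 0 p₁ with h3 | h3
  · rw [abs_of_nonneg h3]; nlinarith
  · rw [abs_of_nonpos h3]; nlinarith

theorem subgradient_mem_band (h : FlatProfile φ ℓ) (hℓ : 0 < ℓ) (hs : |s| ≤ ℓ / 2) {r : ℝ}
    (hr : 0 < r) (ht : r / 2 ≤ t) (htr : t ≤ r)
    (hp : ∀ s' t', φ s t + p₁ * (s' - s) + p₂ * (t' - t) ≤ φ s' t') :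
    φ 0 (r / 4) / (r / 4) ≤ p₂ ∧
      p₂ ≤ φ 0 (r / 4) / (r / 4) + 2 * (φ 0 (4 * r) / (4 * r) - φ 0 (r / 4) / (r / 4)) := by
  have ht0 : 0 < t := by linarith
  have hs' : |s| ≤ ℓ := by linarith
  have hlow : t * (φ 0 (r / 4) / (r / 4)) ≤ φ s t := by
    have h1 := h.slope_mono hℓ (t := r / 4) (t' := t / 2) (by positivity) (by linarith)
    have h2 := h.two_mul_center_le hs' t
    rw [le_div_iff₀ (by positivity)] at h1
    linarith
  have hup : φ s (2 * t) ≤ t * (2 * (φ 0 (4 * r) / (4 * r))) := by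
    have h1 := h.slope_mono hℓ (t := 2 * (2 * t)) (t' := 4 * r) (by positivity) (by linarith)
    have h2 := h.two_mul_le_center hs (2 * t)
    rw [div_le_iff₀ (by positivity)] at h1
    linarith
  have h1 := h.le_of_subgradient hs' hp
  have h2 := hp s (2 * t)
  constructor
  · refine le_of_mul_le_mul_left (a := t) ?_ ht0
    linarith
  · refine le_of_mul_le_mul_left (a := t) ?_ ht0
    linarith

end FlatProfile

/-- Over logarithmically many scales, the increment of a monotone bounded function is small on
one of them. -/
theorem exists_increment_le {g : ℕ → ℝ} {K : ℝ} {N : ℕ} (hN : 0 < N) (h0 : g 0 ≤ K)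
    (hnonneg : 0 ≤ g N) : ∃ k < N, g k - g (k + 1) ≤ K / N := by
  by_contra! hcon
  have hsum : ∑ k ∈ Finset.range N, (g k - g (k + 1)) = g 0 - g N := Finset.sum_range_sub' g N
  have hlt : ∑ k ∈ Finset.range N, K / N < ∑ k ∈ Finset.range N, (g k - g (k + 1)) :=
    Finset.sum_lt_sum_of_nonempty (by simpa using hN.ne') fun k hk => hcon k (Finset.mem_range.1 hk)
  rw [hsum, Finset.sum_const, Finset.card_range, nsmul_eq_mul,
    mul_div_cancel₀ _ (by positivity)] at hlt
  linarith

/-- The profile of `ψ` in the frame `e, f` centred at `m`, relative to the affine function of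
slope `z`. -/
noncomputable def relativeProfile (ψ : Plane → ℝ) (m e f z : Plane) (s t : ℝ) : ℝ :=
  ψ (m + s • e + t • f) - ψ m - inner ℝ z (s • e + t • f)

theorem convexOn_relativeProfile {ψ : Plane → ℝ} (hψ : ConvexOn ℝ univ ψ) (m e f z : Plane) :
    ConvexOn ℝ univ fun v : ℝ × ℝ => relativeProfile ψ m e f z v.1 v.2 := by
  refine ⟨convex_univ, fun v _ w _ a b ha hb hab => ?_⟩
  have h := hψ.2 (mem_univ (m + v.1 • e + v.2 • f)) (mem_univ (m + w.1 • e + w.2 • f)) ha hb hab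
  have hm : m + (a • v + b • w).1 • e + (a • v + b • w).2 • f =
      a • (m + v.1 • e + v.2 • f) + b • (m + w.1 • e + w.2 • f) := by
    obtain rfl : b = 1 - a := by linarith
    simp only [Prod.fst_add, Prod.snd_add, Prod.smul_fst, Prod.smul_snd, smul_eq_mul]
    module
  simp only [relativeProfile, hm, inner_add_right, inner_smul_right, smul_eq_mul] at h ⊢
  simp only [Prod.fst_add, Prod.snd_add, Prod.smul_fst, Prod.smul_snd, smul_eq_mul]
  have : ψ m = a * ψ m + b * ψ m := by rw [← add_mul, hab, one_mul]
  linarith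

theorem relativeProfile_subgradient {ψ : Plane → ℝ} {m e f z p : Plane} {s t : ℝ}
    (hp : p ∈ subdiff ψ (m + s • e + t • f)) (s' t' : ℝ) :
    relativeProfile ψ m e f z s t + inner ℝ (p - z) e * (s' - s) + inner ℝ (p - z) f * (t' - t) ≤
      relativeProfile ψ m e f z s' t' := by
  have h := hp (m + s' • e + t' • f)
  have hd : m + s' • e + t' • f - (m + s • e + t • f) = (s' - s) • e + (t' - t) • f := by module
  rw [hd] at h
  simp only [relativeProfile, inner_add_right, inner_smul_right, inner_sub_left] at h ⊢
  linarith

theorem flatProfile_relativeProfile {ψ : Plane → ℝ} (hψ : ConvexOn ℝ univ ψ) {m e f z : Plane}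
    {ℓ : ℝ} (hℓ : 0 < ℓ) (hz : z ∈ subdiff ψ m)
    (haff : AffineOnSegment ψ (m - ℓ • e) (m + ℓ • e)) :
    FlatProfile (relativeProfile ψ m e f z) ℓ where
  convex := convexOn_relativeProfile hψ m e f z
  nonneg s t := by
    have := hz (m + s • e + t • f)
    rw [add_assoc, add_sub_cancel_left] at this
    simp only [relativeProfile, add_assoc]
    linarith
  flat s hs := by
    obtain ⟨hs1, hs2⟩ := abs_le.1 hs
    have hm := haff (1 / 2) ⟨by norm_num, by norm_num⟩
    rw [show (1 - 1 / 2 : ℝ) • (m - ℓ • e) + (1 / 2 : ℝ) • (m + ℓ • e) = m by module] at hm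
    have h1 := hz (m - ℓ • e)
    have h2 := hz (m + ℓ • e)
    rw [sub_sub_cancel_left, inner_neg_right, inner_smul_right] at h1
    rw [add_sub_cancel_left, inner_smul_right] at h2
    have hst := haff ((s + ℓ) / (2 * ℓ)) ⟨by apply div_nonneg <;> linarith,
      by rw [div_le_one (by positivity)]; linarith⟩
    have hpt : (1 - (s + ℓ) / (2 * ℓ)) • (m - ℓ • e) + ((s + ℓ) / (2 * ℓ)) • (m + ℓ • e) =
        m + s • e := by
      have : s = -ℓ + 2 * ((s + ℓ) / (2 * ℓ) * ℓ) := by field_simp; ring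
      generalize (s + ℓ) / (2 * ℓ) = τ at this ⊢
      rw [this]
      module
    rw [hpt] at hst
    have e1 : ψ (m - ℓ • e) = ψ m - ℓ * inner ℝ z e := by linarith
    have e2 : ψ (m + ℓ • e) = ψ m + ℓ * inner ℝ z e := by linarith
    rw [e1, e2] at hst
    have e3 : (1 - (s + ℓ) / (2 * ℓ)) * (ψ m - ℓ * inner ℝ z e) +
        (s + ℓ) / (2 * ℓ) * (ψ m + ℓ * inner ℝ z e) = ψ m + s * inner ℝ z e := by
      field_simp; ring
    simp only [relativeProfile, zero_smul, add_zero, inner_smul_right]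
    linarith

/-- A convex function `ψ` agreeing on the segment `[m - ℓ e, m + ℓ e]` with its supporting
affine function of slope `z`, above which `Ω` contains a rectangle of height `δ`. -/
structure FlatConfiguration (μ ν : Measure Plane) (ψ : Plane → ℝ) (Ω : Set Plane)
    (h₁ h₂ Λ₁ Λ₂ δ K : ℝ) (m e f z : Plane) (ℓ : ℝ) : Prop where
  convex : ConvexOn ℝ univ ψ
  h₁_pos : 0 < h₁
  h₂_pos : 0 < h₂
  Λ₁_pos : 0 < Λ₁
  Λ₂_pos : 0 < Λ₂
  δ_pos : 0 < δ
  K_pos : 0 < K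
  ℓ_pos : 0 < ℓ
  transport : TransportIneq μ ν ψ Ω
  bounds : MeasureBounds μ ν ψ Ω h₁ h₂ Λ₁ Λ₂
  frame : IsFrame e f
  profile : FlatProfile (relativeProfile ψ m e f z) ℓ
  rectangle_subset : ∀ s t, |s| ≤ ℓ → 0 ≤ t → t ≤ δ → m + s • e + t • f ∈ Ω
  norm_le : ∀ s t, |s| ≤ ℓ → 0 ≤ t → t < δ → ∀ p ∈ subdiff ψ (m + s • e + t • f), ‖p - z‖ ≤ K

namespace FlatConfiguration

variable {μ ν : Measure Plane} {ψ : Plane → ℝ} {Ω : Set Plane} {h₁ h₂ Λ₁ Λ₂ δ K : ℝ}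
  {m e f z : Plane} {ℓ : ℝ}

theorem inner_le (c : FlatConfiguration μ ν ψ Ω h₁ h₂ Λ₁ Λ₂ δ K m e f z ℓ) {s t : ℝ}
    (hs : |s| ≤ ℓ) (ht : 0 ≤ t) (htδ : t < δ) {p : Plane}
    (hp : p ∈ subdiff ψ (m + s • e + t • f)) : inner ℝ (p - z) f ≤ K := by
  have h := real_inner_le_norm (p - z) f
  rw [c.frame.2.1, mul_one] at h
  exact h.trans (c.norm_le s t hs ht htδ p hp)

theorem area_le_of_subgradient_mem (c : FlatConfiguration μ ν ψ Ω h₁ h₂ Λ₁ Λ₂ δ K m e f z ℓ)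
    (hℓ : h₁ ≤ ℓ) {t₀ b a W H : ℝ} (ht₀ : 0 ≤ t₀) (hb : h₁ ≤ b) (htb : t₀ + b < δ) (hW : h₂ ≤ W)
    (hH : h₂ ≤ H)
    (hbox : ∀ s t p₁ p₂, |s| ≤ ℓ / 2 → t₀ ≤ t → t ≤ t₀ + b → p₂ ≤ K →
      (∀ s' t', relativeProfile ψ m e f z s t + p₁ * (s' - s) + p₂ * (t' - t) ≤
        relativeProfile ψ m e f z s' t') → |p₁| ≤ W / 2 ∧ a ≤ p₂ ∧ p₂ ≤ a + H) :
    ℓ * b ≤ Λ₁ * Λ₂ * (W * H) := by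
  have hℓ0 := c.ℓ_pos
  have hpoint : ∀ q ∈ rectangle (m - (ℓ / 2) • e + t₀ • f) e f ℓ b, ∃ s t, |s| ≤ ℓ / 2 ∧
      t₀ ≤ t ∧ t ≤ t₀ + b ∧ q = m + s • e + t • f := by
    rintro q ⟨s, hs, t, ht, rfl⟩
    refine ⟨s - ℓ / 2, t₀ + t, abs_le.2 ⟨by linarith [hs.1], by linarith [hs.2]⟩,
      by linarith [ht.1], by linarith [ht.2], by module⟩
  refine area_le_of_subdiff_subset c.Λ₁_pos c.Λ₂_pos c.h₁_pos c.h₂_pos c.transport c.bounds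
    c.frame hℓ hb ?_ (z - (W / 2) • e + a • f) hW hH ?_ (p := m - (ℓ / 2) • e + t₀ • f)
  · intro q hq
    obtain ⟨s, t, hs, ht, htb', rfl⟩ := hpoint q hq
    exact c.rectangle_subset s t (by linarith) (by linarith) (by linarith)
  · intro q hq p hp
    obtain ⟨s, t, hs, ht, htb', rfl⟩ := hpoint q hq
    obtain ⟨h1, h2, h3⟩ := hbox s t _ _ hs ht htb'
      (c.inner_le (by linarith) (by linarith) (by linarith) hp)
      (fun s' t' => relativeProfile_subgradient hp s' t')
    obtain ⟨h4, h5⟩ := abs_le.1 h1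
    have hd : p - (z - (W / 2) • e + a • f) = (p - z) + (W / 2) • e - a • f := by module
    have hee : inner ℝ e e = (1 : ℝ) := by rw [real_inner_self_eq_norm_sq, c.frame.1]; norm_num
    have hff : inner ℝ f f = (1 : ℝ) := by rw [real_inner_self_eq_norm_sq, c.frame.2.1]; norm_num
    have hef := c.frame.2.2
    have hfe : inner ℝ f e = (0 : ℝ) := by rw [real_inner_comm]; exact hef
    have hx : inner ℝ (p - (z - (W / 2) • e + a • f)) e = inner ℝ (p - z) e + W / 2 := by
      rw [hd, inner_sub_left, inner_add_left, inner_smul_left, inner_smul_left, hee, hfe]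
      simp
    have hy : inner ℝ (p - (z - (W / 2) • e + a • f)) f = inner ℝ (p - z) f - a := by
      rw [hd, inner_sub_left, inner_add_left, inner_smul_left, inner_smul_left, hff, hef]
      simp
    rw [hx, hy]
    exact ⟨⟨by linarith, by linarith⟩, by linarith, by linarith⟩

/-- The area comparison on the rectangle at heights between `δ / 4` and `3 δ / 4`. -/
theorem half_area_le (c : FlatConfiguration μ ν ψ Ω h₁ h₂ Λ₁ Λ₂ δ K m e f z ℓ)
    (hℓ : h₁ ≤ ℓ) (hδ : h₁ ≤ δ / 4) :
    ℓ * (δ / 2) ≤ Λ₁ * Λ₂ * (max (3 * K * δ / ℓ) h₂ * max K h₂) := by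
  have hℓ0 := c.ℓ_pos
  have hδ0 := c.δ_pos
  have hK0 := c.K_pos
  refine c.area_le_of_subgradient_mem hℓ (t₀ := δ / 4) (a := 0) (by positivity) (by linarith)
    (by linarith) (le_max_right _ _) (le_max_right _ _) fun s t p₁ p₂ hs ht ht' hpK hp => ?_
  have ht0 : 0 < t := by linarith
  have h1 := c.profile.abs_mul_le_of_subgradient hℓ0 hs hp
  have h2 : p₂ * t ≤ K * (3 * δ / 4) := by
    calc p₂ * t ≤ K * t := by gcongr
      _ ≤ K * (3 * δ / 4) := by gcongr; linarith
  refine ⟨?_, ?_, ?_⟩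
  · have h3 : |p₁| ≤ 3 * K * δ / ℓ / 2 := by
      rw [div_div, le_div_iff₀ (by positivity)]
      linarith
    linarith [le_max_left (3 * K * δ / ℓ) h₂]
  · have h3 := c.profile.le_of_subgradient (by linarith) hp
    have h4 := c.profile.nonneg s t
    exact nonneg_of_mul_nonneg_left (h4.trans h3) ht0
  · linarith [le_max_left K h₂]

theorem half_scale_area_le (c : FlatConfiguration μ ν ψ Ω h₁ h₂ Λ₁ Λ₂ δ K m e f z ℓ)
    (hℓ : h₁ ≤ ℓ) {r : ℝ} (hr : 0 < r) (hrδ : 4 * r < δ) (hr₁ : 2 * h₁ ≤ r)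
    (hr₂ : h₂ ≤ 4 * K * r / ℓ) :
    ℓ * (r / 2) ≤ Λ₁ * Λ₂ * (4 * K * r / ℓ *
      max (2 * (relativeProfile ψ m e f z 0 (4 * r) / (4 * r) -
        relativeProfile ψ m e f z 0 (r / 4) / (r / 4))) h₂) := by
  have hℓ0 := c.ℓ_pos
  have hK0 := c.K_pos
  refine c.area_le_of_subgradient_mem hℓ (t₀ := r / 2)
    (a := relativeProfile ψ m e f z 0 (r / 4) / (r / 4)) (by positivity) (by linarith)
    (by linarith) hr₂ (le_max_right _ _) fun s t p₁ p₂ hs ht ht' hpK hp => ?_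
  have ht0 : 0 < t := by linarith
  have h1 := c.profile.abs_mul_le_of_subgradient hℓ0 hs hp
  have h2 : p₂ * t ≤ K * r := by
    calc p₂ * t ≤ K * t := by gcongr
      _ ≤ K * r := by gcongr; linarith
  obtain ⟨h3, h4⟩ := c.profile.subgradient_mem_band hℓ0 hs hr ht (by linarith) hp
  refine ⟨?_, h3, h4.trans (by gcongr; exact le_max_left _ _)⟩
  rw [div_div, le_div_iff₀ (by positivity)]
  linarith

theorem slope_le (c : FlatConfiguration μ ν ψ Ω h₁ h₂ Λ₁ Λ₂ δ K m e f z ℓ) {t : ℝ} (ht : 0 < t)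
    (htδ : t < δ) : relativeProfile ψ m e f z 0 t / t ≤ K := by
  have hℓ : |(0 : ℝ)| ≤ ℓ := by simpa using c.ℓ_pos.le
  obtain ⟨p, hp⟩ := subdiff_nonempty c.convex (m + (0 : ℝ) • e + t • f)
  have h1 := c.profile.le_of_subgradient hℓ (relativeProfile_subgradient (z := z) hp)
  rw [div_le_iff₀ ht]
  exact h1.trans (by gcongr; exact c.inner_le hℓ ht.le htδ hp)

/-- The one-scale bound on the half-length of the flat part. -/
theorem sq_le (c : FlatConfiguration μ ν ψ Ω h₁ h₂ Λ₁ Λ₂ δ K m e f z ℓ)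
    (hℓ : h₁ ≤ ℓ) (hδ : h₁ ≤ δ / 4) (hh : √(128 * Λ₁ * Λ₂) * h₂ < δ)
    (hh' : ℓ * h₂ / K ≤ 128 * δ / 2) :
    ℓ ^ 2 ≤ 128 * Λ₁ * Λ₂ * K * h₂ ∨ ℓ ^ 2 ≤ 8 * Λ₁ * Λ₂ * K ^ 2 := by
  have hℓ0 := c.ℓ_pos
  have hδ0 := c.δ_pos
  have hK0 := c.K_pos
  have hh0 := c.h₂_pos
  have hΛ : 0 < Λ₁ * Λ₂ := mul_pos c.Λ₁_pos c.Λ₂_pos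
  have key := c.half_area_le hℓ hδ
  rw [div_le_iff₀ hK0] at hh'
  set Λ := Λ₁ * Λ₂ with hΛdef
  rw [mul_assoc 128, ← hΛdef] at hh ⊢
  rw [mul_assoc 8, ← hΛdef]
  rcases le_total (3 * K * δ / ℓ) h₂ with hW | hW
  · rw [max_eq_right hW] at key
    rcases le_total K h₂ with hH | hH
    · rw [max_eq_right hH] at key
      left
      have : ℓ * h₂ * ℓ ≤ (64 * δ * K) * ℓ := by nlinarith
      have h2 : ℓ ^ 2 * h₂ ≤ 128 * Λ * K * h₂ * h₂ := by nlinarith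
      exact le_of_mul_le_mul_right h2 hh0
    · rw [max_eq_left hH] at key
      right
      have h1 : ℓ * (√(128 * Λ) * h₂) ≤ 2 * Λ * (h₂ * K) := by
        calc ℓ * (√(128 * Λ) * h₂) ≤ ℓ * δ := by gcongr
          _ ≤ _ := by linarith
      have h2 : ℓ * √(128 * Λ) ≤ 2 * Λ * K := by
        refine le_of_mul_le_mul_right (a := h₂) ?_ hh0
        linarith
      have h3 : (ℓ * √(128 * Λ)) ^ 2 ≤ (2 * Λ * K) ^ 2 := by gcongr
      rw [mul_pow, Real.sq_sqrt (by positivity)] at h3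
      have h4 : ℓ ^ 2 * Λ ≤ 8 * Λ * K ^ 2 * Λ := by nlinarith [sq_nonneg (Λ * K)]
      exact le_of_mul_le_mul_right h4 hΛ
  · rw [max_eq_left hW] at key
    have h1 : ℓ ^ 2 ≤ 6 * Λ * K * max K h₂ := by
      have h2 : ℓ * (δ / 2) * ℓ ≤ Λ * (3 * K * δ / ℓ * max K h₂) * ℓ := by gcongr
      have h3 : Λ * (3 * K * δ / ℓ * max K h₂) * ℓ = Λ * 3 * K * max K h₂ * δ := by
        field_simp
      rw [h3] at h2
      refine le_of_mul_le_mul_right (a := δ) ?_ hδ0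
      linarith
    rcases le_total K h₂ with hH | hH
    · rw [max_eq_right hH] at h1
      left
      have : 0 < Λ * K * h₂ := by positivity
      linarith
    · rw [max_eq_left hH] at h1
      right
      have : 0 < Λ * K ^ 2 := by positivity
      linarith

/-- The improved bound obtained by selecting the best of `N` scales. -/
theorem sq_le_of_scales (c : FlatConfiguration μ ν ψ Ω h₁ h₂ Λ₁ Λ₂ δ K m e f z ℓ)
    (hℓ : h₁ ≤ ℓ) {N : ℕ} (hN : 0 < N) {ρ : ℝ} (hρ₁ : 2 * h₁ ≤ ρ) (hρ₂ : ℓ * h₂ / (4 * K) ≤ ρ)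
    (hρN : ρ * (8 * 16 ^ (N - 1)) ≤ δ) :
    ℓ ^ 2 ≤ 8 * Λ₁ * Λ₂ * K * max (2 * (K / N)) h₂ := by
  have hℓ0 := c.ℓ_pos
  have hδ0 := c.δ_pos
  have hK0 := c.K_pos
  have hΛ : 0 < Λ₁ * Λ₂ := mul_pos c.Λ₁_pos c.Λ₂_pos
  set g : ℕ → ℝ := fun k =>
    relativeProfile ψ m e f z 0 (δ / 2 / 16 ^ k) / (δ / 2 / 16 ^ k) with hg
  obtain ⟨k, hk, hgk⟩ := exists_increment_le (g := g) (K := K) hN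
    (c.slope_le (by positivity) (by rw [pow_zero]; linarith))
    (div_nonneg (c.profile.nonneg _ _) (by positivity))
  set r : ℝ := δ / 8 / 16 ^ k with hr
  have hr0 : 0 < r := by positivity
  have hrρ : ρ ≤ r := by
    rw [hr, div_div, le_div_iff₀ (by positivity)]
    refine le_trans ?_ hρN
    have hρ0 : 0 ≤ ρ := by linarith [c.h₁_pos]
    gcongr
    · norm_num
    · omega
  have e1 : δ / 2 / 16 ^ k = 4 * r := by rw [hr]; ring
  have e2 : δ / 2 / 16 ^ (k + 1) = r / 4 := by rw [hr, pow_succ]; field_simp; norm_num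
  have hrδ : 4 * r < δ := by
    rw [← e1]
    calc δ / 2 / 16 ^ k ≤ δ / 2 := div_le_self (by positivity) (one_le_pow₀ (by norm_num))
      _ < δ := by linarith
  have key := c.half_scale_area_le hℓ hr0 hrδ (by linarith) (by
    rw [le_div_iff₀ hℓ0]
    have := hρ₂.trans hrρ
    rw [div_le_iff₀ (by positivity)] at this
    linarith)
  simp only [hg] at hgk
  rw [e1, e2] at hgk
  have h1 : ℓ * (r / 2) ≤ Λ₁ * Λ₂ * (4 * K * r / ℓ * max (2 * (K / N)) h₂) :=
    key.trans (by gcongr)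
  have h2 : ℓ * (r / 2) * ℓ ≤ Λ₁ * Λ₂ * (4 * K * r / ℓ * max (2 * (K / N)) h₂) * ℓ := by gcongr
  have h3 : Λ₁ * Λ₂ * (4 * K * r / ℓ * max (2 * (K / N)) h₂) * ℓ =
      Λ₁ * Λ₂ * 4 * K * max (2 * (K / N)) h₂ * r := by field_simp
  rw [h3] at h2
  refine le_of_mul_le_mul_right (a := r) ?_ hr0
  linarith

/-- The logarithmic bound in terms of the finest admissible scale `ρ`. -/
theorem le_max_of_log (c : FlatConfiguration μ ν ψ Ω h₁ h₂ Λ₁ Λ₂ δ K m e f z ℓ)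
    (hℓ : h₁ ≤ ℓ) (hδ : h₁ ≤ δ / 4) (hh : √(128 * Λ₁ * Λ₂) * h₂ < δ)
    (hh' : ℓ * h₂ / K ≤ 128 * δ / 2) {ρ : ℝ} (hρδ : ρ < δ) (hρ₁ : 2 * h₁ ≤ ρ)
    (hρ₂ : √(128 * Λ₁ * Λ₂) * h₂ ≤ ρ) :
    ℓ ≤ √(128 * Λ₁ * Λ₂ * K * h₂) ∨
      ℓ ≤ K * √(128 * Λ₁ * Λ₂) / Real.log (δ / ρ) ^ (1 / 8 : ℝ) := by
  have hℓ0 := c.ℓ_pos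
  have hδ0 := c.δ_pos
  have hK0 := c.K_pos
  have hh0 := c.h₂_pos
  have hΛ₁ := c.Λ₁_pos
  have hΛ₂ := c.Λ₂_pos
  have hρ0 : 0 < ρ := by linarith [c.h₁_pos]
  rcases le_or_gt (ℓ ^ 2) (128 * Λ₁ * Λ₂ * K * h₂) with hsq | hsq
  · exact Or.inl (Real.le_sqrt_of_sq_le hsq)
  right
  have h8 : ℓ ^ 2 ≤ 8 * Λ₁ * Λ₂ * K ^ 2 :=
    (c.sq_le hℓ hδ hh hh').resolve_left (not_le.2 hsq)
  set L := Real.log (δ / ρ) with hL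
  have hL0 : 0 < L := Real.log_pos ((one_lt_div hρ0).2 hρδ)
  have hLpow : 0 < L ^ (1 / 8 : ℝ) := Real.rpow_pos_of_pos hL0 _
  have hmain : ℓ ^ 2 * (L ^ (1 / 8 : ℝ)) ^ 2 ≤ 128 * Λ₁ * Λ₂ * K ^ 2 := by
    rcases le_or_gt L 4 with hL4 | hL4
    · have h1 : L ^ (1 / 8 : ℝ) ≤ 4 := by
        calc L ^ (1 / 8 : ℝ) ≤ 4 ^ (1 / 8 : ℝ) := by gcongr
          _ ≤ 4 ^ (1 : ℝ) := Real.rpow_le_rpow_of_exponent_le (by norm_num) (by norm_num)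
          _ = 4 := Real.rpow_one _
      calc ℓ ^ 2 * (L ^ (1 / 8 : ℝ)) ^ 2 ≤ 8 * Λ₁ * Λ₂ * K ^ 2 * 4 ^ 2 := by gcongr
        _ = _ := by ring
    · have h1 : (L ^ (1 / 8 : ℝ)) ^ 2 ≤ L := by
        rw [← Real.rpow_natCast, ← Real.rpow_mul hL0.le]
        calc L ^ (1 / 8 * ((2 : ℕ) : ℝ)) ≤ L ^ (1 : ℝ) :=
              Real.rpow_le_rpow_of_exponent_le (by linarith) (by norm_num)
          _ = L := Real.rpow_one _
      set N := ⌈L / 8⌉₊ with hNdef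
      have hN : 0 < N := Nat.ceil_pos.2 (by positivity)
      have hNle : L / 8 ≤ N := Nat.le_ceil _
      have hNlt : ((N - 1 : ℕ) : ℝ) < L / 8 := Nat.lt_ceil.1 (by omega)
      have hℓK : ℓ ≤ K * √(128 * Λ₁ * Λ₂) := by
        refine abs_le_of_sq_le_sq' ?_ (by positivity) |>.2
        rw [mul_pow, Real.sq_sqrt (by positivity)]
        have : 0 < Λ₁ * Λ₂ * K ^ 2 := by positivity
        linarith
      have hρ₂' : ℓ * h₂ / (4 * K) ≤ ρ := by
        rw [div_le_iff₀ (by positivity)]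
        calc ℓ * h₂ ≤ K * √(128 * Λ₁ * Λ₂) * h₂ := by gcongr
          _ = √(128 * Λ₁ * Λ₂) * h₂ * K := by ring
          _ ≤ ρ * K := by gcongr
          _ ≤ ρ * (4 * K) := by gcongr; linarith
      have hpow : (8 : ℝ) * 16 ^ (N - 1) ≤ δ / ρ := by
        have h8e : (8 : ℝ) ≤ Real.exp (5 / 2) := by
          have h5 : (8 : ℝ) ^ 2 ≤ Real.exp (5 / 2) ^ 2 := by
            calc (8 : ℝ) ^ 2 ≤ 2.7 ^ 5 := by norm_num
              _ ≤ Real.exp 1 ^ 5 := by gcongr; linarith [Real.exp_one_gt_d9]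
              _ = Real.exp (5 / 2) ^ 2 := by
                rw [← Real.exp_nat_mul, ← Real.exp_nat_mul]; norm_num
          exact (abs_le_of_sq_le_sq' h5 (Real.exp_pos _).le).2
        have h16 : (16 : ℝ) ≤ Real.exp 3 := by
          calc (16 : ℝ) ≤ 2.7 ^ 3 := by norm_num
            _ ≤ Real.exp 1 ^ 3 := by gcongr; linarith [Real.exp_one_gt_d9]
            _ = Real.exp 3 := by rw [← Real.exp_nat_mul]; norm_num
        calc (8 : ℝ) * 16 ^ (N - 1) ≤ Real.exp (5 / 2) * Real.exp 3 ^ (N - 1) := by gcongr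
          _ = Real.exp (5 / 2 + (N - 1 : ℕ) * 3) := by rw [Real.exp_add, Real.exp_nat_mul]
          _ ≤ Real.exp L := Real.exp_le_exp.2 (by linarith)
          _ = δ / ρ := Real.exp_log (by positivity)
      have hscales := c.sq_le_of_scales hℓ hN hρ₁ hρ₂' (by
        rw [le_div_iff₀ hρ0] at hpow
        linarith)
      rcases le_total (2 * (K / N)) h₂ with hcmp | hcmp
      · rw [max_eq_right hcmp] at hscales
        have : 0 < Λ₁ * Λ₂ * K * h₂ := by positivity
        linarith
      · rw [max_eq_left hcmp] at hscales
        have hN0 : (0 : ℝ) < N := by exact_mod_cast hN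
        have hKN : K / N * L ≤ 8 * K := by
          rw [div_mul_eq_mul_div, div_le_iff₀ hN0]
          nlinarith
        calc ℓ ^ 2 * (L ^ (1 / 8 : ℝ)) ^ 2 ≤ 8 * Λ₁ * Λ₂ * K * (2 * (K / N)) * L := by gcongr
          _ = 16 * Λ₁ * Λ₂ * K * (K / N * L) := by ring
          _ ≤ 16 * Λ₁ * Λ₂ * K * (8 * K) := by gcongr
          _ = _ := by ring
  rw [le_div_iff₀ hLpow]
  refine (abs_le_of_sq_le_sq' ?_ (by positivity)).2
  rw [mul_pow, mul_pow, Real.sq_sqrt (by positivity)]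
  linarith

end FlatConfiguration

theorem tendsto_const_div_log_rpow (A : ℝ) {a δ : ℝ} (ha : 0 < a) (hδ : 0 < δ) :
    Tendsto (fun h : ℝ => A / Real.log (δ / (a * h)) ^ (1 / 8 : ℝ)) (𝓝[>] 0) (𝓝 0) := by
  refine Tendsto.const_div_atTop ?_ A
  refine (tendsto_rpow_atTop (by norm_num)).comp (Real.tendsto_log_atTop.comp ?_)
  have h := tendsto_inv_nhdsGT_zero (𝕜 := ℝ).const_mul_atTop (div_pos hδ ha)
  refine h.congr fun x => ?_
  rw [div_mul_eq_div_div, div_eq_mul_inv (δ / a)]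

theorem tendsto_flatBound {C Λ₁ Λ₂ K δ : ℝ} (hC : 0 < C) (hΛ₁ : 0 < Λ₁) (hΛ₂ : 0 < Λ₂)
    (hδ : 0 < δ) :
    Tendsto (fun h : ℝ × ℝ => flatBound C Λ₁ Λ₂ K δ h.1 h.2)
      (𝓝[>] (0 : ℝ) ×ˢ 𝓝[>] (0 : ℝ)) (𝓝 0) := by
  have hid : Tendsto (fun h : ℝ => h) (𝓝[>] 0) (𝓝 0) := tendsto_nhdsWithin_of_tendsto_nhds tendsto_id
  have t1 : Tendsto (fun h : ℝ × ℝ => 2 * h.1) (𝓝[>] (0 : ℝ) ×ˢ 𝓝[>] (0 : ℝ)) (𝓝 0) := by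
    simpa using (hid.comp tendsto_fst).const_mul 2
  have t2 : Tendsto (fun h : ℝ × ℝ => √(C * Λ₁ * Λ₂ * K * h.2))
      (𝓝[>] (0 : ℝ) ×ˢ 𝓝[>] (0 : ℝ)) (𝓝 0) := by
    simpa using ((hid.comp tendsto_snd).const_mul (C * Λ₁ * Λ₂ * K)).sqrt
  have t3 := (tendsto_const_div_log_rpow (K * √(C * Λ₁ * Λ₂)) two_pos hδ).comp
    (tendsto_fst (f := 𝓝[>] (0 : ℝ)) (g := 𝓝[>] (0 : ℝ)))
  have t4 := (tendsto_const_div_log_rpow (K * √(C * Λ₁ * Λ₂))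
    (a := √(C * Λ₁ * Λ₂)) (by positivity) hδ).comp
    (tendsto_snd (f := 𝓝[>] (0 : ℝ)) (g := 𝓝[>] (0 : ℝ)))
  simpa [flatBound, Function.comp_def] using (t1.max t2).max (t3.max t4)

/-- The data of a flat segment, put in the frame of the rectangle above it. -/
theorem exists_flatConfiguration {μ ν : Measure Plane} {ψ : Plane → ℝ} {Ω : Set Plane}
    {h₁ h₂ Λ₁ Λ₂ δ K : ℝ} {x y : Plane} (hψ : ConvexOn ℝ univ ψ) (hh₁ : 0 < h₁) (hh₂ : 0 < h₂)
    (hΛ₁ : 0 < Λ₁) (hΛ₂ : 0 < Λ₂) (hδ : 0 < δ) (hK : 0 < K) (hT : TransportIneq μ ν ψ Ω)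
    (hB : MeasureBounds μ ν ψ Ω h₁ h₂ Λ₁ Λ₂) (hR : ContainsRectangleOn Ω x y δ)
    (hdiam : Metric.diam (subdiffImage ψ (segmentNhd x y δ)) ≤ K)
    (haff : AffineOnSegment ψ x y) (hxy : x ≠ y) :
    ∃ m e f z, FlatConfiguration μ ν ψ Ω h₁ h₂ Λ₁ Λ₂ δ K m e f z (dist x y / 2) := by
  obtain ⟨e, f, hef, hy, hsub⟩ := hR
  set ℓ := dist x y / 2 with hℓ
  have hℓ0 : 0 < ℓ := by have := dist_pos.2 hxy; positivity
  have hnorm : ‖y - x‖ = 2 * ℓ := by rw [hℓ, ← dist_eq_norm, dist_comm]; ring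
  rw [hnorm] at hy hsub
  set m := x + ℓ • e with hm
  have hxm : x = m - ℓ • e := by rw [hm]; module
  have hym : y = m + ℓ • e := by rw [hy, hm]; module
  obtain ⟨z, hz⟩ := subdiff_nonempty hψ m
  have hseg : ∀ s, |s| ≤ ℓ → m + s • e ∈ segment ℝ x y := by
    intro s hs
    obtain ⟨hs1, hs2⟩ := abs_le.1 hs
    rw [segment_eq_image']
    refine ⟨(s + ℓ) / (2 * ℓ), ⟨by apply div_nonneg <;> linarith,
      by rw [div_le_one (by positivity)]; linarith⟩, ?_⟩
    have hyx : y - x = (2 * ℓ) • e := by rw [hy]; module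
    simp only [hyx, smul_smul]
    rw [div_mul_cancel₀ _ (by positivity), hm]
    module
  have hbdd : Bornology.IsBounded (subdiffImage ψ (segmentNhd x y δ)) := by
    refine isBounded_subdiffImage hψ ?_
    have : segmentNhd x y δ = Metric.thickening δ (segment ℝ x y) :=
      (Metric.thickening_eq_biUnion_ball).symm
    rw [this]
    have hbs : Bornology.IsBounded (segment ℝ x y) := by
      rw [← convexHull_pair, isBounded_convexHull]
      exact (Set.toFinite _).isBounded
    exact hbs.thickening
  have hmem : ∀ s t, |s| ≤ ℓ → 0 ≤ t → t < δ → ∀ p ∈ subdiff ψ (m + s • e + t • f),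
      p ∈ subdiffImage ψ (segmentNhd x y δ) := by
    intro s t hs ht htδ p hp
    simp only [subdiffImage, mem_iUnion]
    refine ⟨m + s • e + t • f, ?_, hp⟩
    simp only [segmentNhd, mem_iUnion]
    refine ⟨_, hseg s hs, ?_⟩
    rw [Metric.mem_ball, dist_eq_norm, add_sub_cancel_left, norm_smul, hef.2.1, mul_one,
      Real.norm_eq_abs, abs_of_nonneg ht]
    exact htδ
  refine ⟨m, e, f, z, hψ, hh₁, hh₂, hΛ₁, hΛ₂, hδ, hK, hℓ0, hT, hB, hef,
    flatProfile_relativeProfile hψ hℓ0 hz (hxm ▸ hym ▸ haff), ?_, ?_⟩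
  · intro s t hs ht htδ
    obtain ⟨hs1, hs2⟩ := abs_le.1 hs
    exact hsub ⟨s + ℓ, ⟨by linarith, by linarith⟩, t, ⟨ht, htδ⟩, by rw [hm]; module⟩
  · intro s t hs ht htδ p hp
    rw [← dist_eq_norm]
    refine (Metric.dist_le_diam_of_mem hbdd (hmem s t hs ht htδ p hp) ?_).trans hdiam
    exact hmem 0 0 (by simpa using hℓ0.le) le_rfl hδ z (by simpa using hz)

theorem corollary1p4 :
    ∃ C : ℝ, 0 < C ∧
      (∀ (Ω : Set Plane) (μ ν : Measure Plane) [IsLocallyFiniteMeasure μ]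
        [IsLocallyFiniteMeasure ν] (ψ : Plane → ℝ) (h₁ h₂ Λ₁ Λ₂ δ K : ℝ) (x y : Plane),
        IsOpen Ω → Bornology.IsBounded Ω →
        ConvexOn ℝ univ ψ →
        0 < h₁ → 0 < h₂ → 0 < Λ₁ → 0 < Λ₂ → 0 < δ → 0 < K →
        TransportIneq μ ν ψ Ω →
        MeasureBounds μ ν ψ Ω h₁ h₂ Λ₁ Λ₂ →
        x ∈ innerSet Ω δ → y ∈ innerSet Ω δ →
        ContainsRectangleOn Ω x y δ →
        Metric.diam (subdiffImage ψ (segmentNhd x y δ)) ≤ K →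
        AffineOnSegment ψ x y →
        h₁ ≤ δ / 4 →
        √(C * Λ₁ * Λ₂) * h₂ < δ →
        ((dist x y / 2) * h₂) / K ≤ C * δ / 2 →
        dist x y / 2 ≤ flatBound C Λ₁ Λ₂ K δ h₁ h₂) ∧
      (∀ Λ₁ Λ₂ δ K : ℝ, 0 < Λ₁ → 0 < Λ₂ → 0 < δ → 0 < K →
        Tendsto (fun h : ℝ × ℝ => flatBound C Λ₁ Λ₂ K δ h.1 h.2)
          (𝓝[>] (0 : ℝ) ×ˢ 𝓝[>] (0 : ℝ)) (𝓝 0)) := by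
  refine ⟨128, by norm_num, ?_, fun Λ₁ Λ₂ δ K hΛ₁ hΛ₂ hδ _ =>
    tendsto_flatBound (by norm_num) hΛ₁ hΛ₂ hδ⟩
  intro Ω μ ν _ _ ψ h₁ h₂ Λ₁ Λ₂ δ K x y _ _ hψ hh₁ hh₂ hΛ₁ hΛ₂ hδ hK hT hB _ _ hR hdiam haff
    hδ₁ hδ₂ hδ₃
  simp only [flatBound, le_max_iff]
  rcases le_or_gt (dist x y / 2) (2 * h₁) with hsmall | hlarge
  · exact Or.inl (Or.inl hsmall)
  have hxy : x ≠ y := by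
    rintro rfl
    rw [dist_self] at hlarge
    linarith
  obtain ⟨m, e, f, z, c⟩ :=
    exists_flatConfiguration hψ hh₁ hh₂ hΛ₁ hΛ₂ hδ hK hT hB hR hdiam haff hxy
  rcases le_total (√(128 * Λ₁ * Λ₂) * h₂) (2 * h₁) with h | h
  · rcases c.le_max_of_log (by linarith) hδ₁ hδ₂ hδ₃ (by linarith) le_rfl h with h | h
    · exact Or.inl (Or.inr h)
    · exact Or.inr (Or.inl h)
  · rcases c.le_max_of_log (by linarith) hδ₁ hδ₂ hδ₃ hδ₂ h le_rfl with h | h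
    · exact Or.inl (Or.inr h)
    · exact Or.inr (Or.inr h)
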